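/- Let $\mathcal N$ be a smooth (Hausdorff) $m$-dimensional manifold, $\gamma$ a smooth symmetric two-covariant tensor field, $\boldsymbol\ell$ a smooth one-form and $\ell^{(2)}$ a smooth function on $\mathcal N$, such that at every $p\in\mathcal N$ the symmetric bilinear form on $T_p\mathcal N\times\mathbb R$ \[ \mathcal A|_p((W,a),(Z,b)) = \gamma(W,Z)+a\,\boldsymbol\ell(Z)+b\,\boldsymbol\ell(W)+ab\,\ell^{(2)} \] is non-degenerate (\emph{metric hypersurface data}; no signature is assumed). Let $\mathcal A^\sharp$ be the inverse of $\mathcal A$, and define the vector field $n$ and the function $n^{(2)}$ by $\beta(n)=\mathcal A^\sharp((0,1),(\beta,0))$ for all covectors $\beta$ and $n^{(2)}=\mathcal A^\sharp((0,1),(0,1))$. Write $\alpha\otimes_s\beta=\tfrac12(\alpha\otimes\beta+\beta\otimes\alpha)$, let $\pounds$ denote the Lie derivative, and put $U=\tfrac12\pounds_n\gamma+\boldsymbol\ell\otimes_s dn^{(2)}$. The \emph{metric hypersurface connection} $\stackrel{\circ}{\nabla}$ of the data is the unique smooth torsion-free connection such that for all smooth vector fields $X,Z,W$ \[ (\stackrel{\circ}{\nabla}_X\gamma)(Z,W)=-U(X,Z)\boldsymbol\ell(W)-U(X,W)\boldsymbol\ell(Z),\qquad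 (\stackrel{\circ}{\nabla}_X\boldsymbol\ell)(Z)+(\stackrel{\circ}{\nabla}_Z\boldsymbol\ell)(X)=-2\ell^{(2)}U(X,Z). \] Let $u$ be a nowhere zero smooth function and $\zeta$ a smooth vector field on $\mathcal N$. The gauge transformed data with parameters $(u,\zeta)$ are \[ \mathcal G_{(u,\zeta)}(\gamma)=\gamma,\quad \mathcal G_{(u,\zeta)}(\boldsymbol\ell)=u\,(\boldsymbol\ell+\gamma(\zeta,\cdot)),\quad \mathcal G_{(u,\zeta)}(\ell^{(2)})=u^2\bigl(\ell^{(2)}+2\boldsymbol\ell(\zeta)+\gamma(\zeta,\zeta)\bigr), \] which are again metric hypersurface data. Then the metric hypersurface connections $\stackrel{\circ}{\nabla}$ of the original data and $\mathcal G_{(u,\zeta)}(\stackrel{\circ}{\nabla})$ of the transformed data exist and are unique, and their difference tensor is \[ \mathcal G_{(u,\zeta)}(\stackrel{\circ}{\nabla})-\stackrel{\circ}{\nabla}=\frac1{2u}\,\zeta\otimes\Bigl(\pounds_{un}\gamma-n^{(2)}\pounds_{u\zeta}\gamma+2u\,\boldsymbol\ell\otimes_s dn^{(2)}\Bigr)+\frac1{2u}\,n\otimes\Bigl(\pounds_{u\zeta}\gamma+2\,\boldsymbol\ell\otimes_s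 du\Bigr), \] where all quantities on the right-hand side are those of the original data. -/

import Mathlib

open scoped Manifold ContDiff Bundle

noncomputable section

/-- The symmetric bilinear form on `V × ℝ`
`((W, a), (Z, b)) ↦ γ(W, Z) + a ℓ(Z) + b ℓ(W) + a b ℓ₂`. -/
def ambientForm {V : Type*} [AddCommGroup V] [Module ℝ V] [TopologicalSpace V]
    (γ : V →L[ℝ] V →L[ℝ] ℝ) (ℓ : V →L[ℝ] ℝ) (ℓ₂ : ℝ) : LinearMap.BilinForm ℝ (V × ℝ) :=
  LinearMap.mk₂ ℝ
    (fun x y => γ x.1 y.1 + x.2 * ℓ y.1 + y.2 * ℓ x.1 + x.2 * y.2 * ℓ₂)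
    (fun x x' y => by simp; ring) (fun c x y => by simp; ring)
    (fun x y y' => by simp; ring) (fun c x y => by simp; ring)

theorem ambientForm_gauge_nondegenerate {V : Type*} [AddCommGroup V] [Module ℝ V]
    [TopologicalSpace V] [IsTopologicalAddGroup V] [ContinuousSMul ℝ V]
    (γ : V →L[ℝ] V →L[ℝ] ℝ) (ℓ : V →L[ℝ] ℝ) (ℓ₂ : ℝ) (hγ : ∀ v w, γ v w = γ w v)
    {u : ℝ} (hu : u ≠ 0) (ζ : V) (h : (ambientForm γ ℓ ℓ₂).Nondegenerate) :
    (ambientForm γ (u • (ℓ + γ ζ)) (u ^ 2 * (ℓ₂ + 2 * ℓ ζ + γ ζ ζ))).Nondegenerate := by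
  have key : ∀ x y : V × ℝ,
      ambientForm γ (u • (ℓ + γ ζ)) (u ^ 2 * (ℓ₂ + 2 * ℓ ζ + γ ζ ζ)) x y =
        ambientForm γ ℓ ℓ₂ (x.1 + (u * x.2) • ζ, u * x.2) (y.1 + (u * y.2) • ζ, u * y.2) := by
    intro x y
    simp [ambientForm, hγ x.1 ζ]
    ring
  have surj : ∀ z : V × ℝ, ∃ y : V × ℝ, (y.1 + (u * y.2) • ζ, u * y.2) = z := fun z =>
    ⟨(z.1 - z.2 • ζ, u⁻¹ * z.2), by simp [mul_inv_cancel_left₀ hu]⟩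
  have inj : ∀ x : V × ℝ, (x.1 + (u * x.2) • ζ, u * x.2) = (0 : V × ℝ) → x = 0 := by
    intro x hx
    obtain ⟨h1, h2⟩ := Prod.ext_iff.mp hx
    have h3 : x.2 = 0 := by simpa [hu] using h2
    have h4 : x.1 = 0 := by simpa [h3] using h1
    exact Prod.ext h4 h3
  refine ⟨fun x hx => inj x (h.1 _ fun z => ?_), fun y hy => inj y (h.2 _ fun z => ?_)⟩
  · obtain ⟨y, rfl⟩ := surj z
    rw [← key]; exact hx y
  · obtain ⟨x, rfl⟩ := surj z
    rw [← key]; exact hy x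

/-- Metric hypersurface data on a smooth `m`-dimensional manifold `N`: a smooth symmetric
two-covariant tensor `γ`, a smooth one-form `ℓ` and a smooth function `ℓ₂` (usually written
`ℓ⁽²⁾`) such that the associated form on `T_p N × ℝ` is non-degenerate for all `p`. -/
structure MetricHypersurfaceData (m : ℕ) (N : Type*) [TopologicalSpace N]
    [ChartedSpace (EuclideanSpace ℝ (Fin m)) N] [IsManifold (𝓡 m) ∞ N] where
  γ : ∀ p : N, TangentSpace (𝓡 m) p →L[ℝ] TangentSpace (𝓡 m) p →L[ℝ] ℝ
  ℓ : ∀ p : N, TangentSpace (𝓡 m) p →L[ℝ] ℝ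
  ℓ₂ : N → ℝ
  symm : ∀ (p : N) (v w : TangentSpace (𝓡 m) p), γ p v w = γ p w v
  smooth_γ : ContMDiff (𝓡 m)
    ((𝓡 m).prod 𝓘(ℝ, EuclideanSpace ℝ (Fin m) →L[ℝ] EuclideanSpace ℝ (Fin m) →L[ℝ] ℝ)) ∞
    (fun p => Bundle.TotalSpace.mk'
      (EuclideanSpace ℝ (Fin m) →L[ℝ] EuclideanSpace ℝ (Fin m) →L[ℝ] ℝ)
      (E := fun p : N => TangentSpace (𝓡 m) p →L[ℝ] TangentSpace (𝓡 m) p →L[ℝ] ℝ) p (γ p))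
  smooth_ℓ : ContMDiff (𝓡 m) ((𝓡 m).prod 𝓘(ℝ, EuclideanSpace ℝ (Fin m) →L[ℝ] ℝ)) ∞
    (fun p => Bundle.TotalSpace.mk' (EuclideanSpace ℝ (Fin m) →L[ℝ] ℝ)
      (E := fun p : N => TangentSpace (𝓡 m) p →L[ℝ] ℝ) p (ℓ p))
  smooth_ℓ₂ : ContMDiff (𝓡 m) 𝓘(ℝ, ℝ) ∞ ℓ₂
  nondegenerate : ∀ p : N, (ambientForm (γ p) (ℓ p) (ℓ₂ p)).Nondegenerate

/-- Smooth vector fields. -/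
abbrev SmoothVectorField (m : ℕ) (N : Type*) [TopologicalSpace N]
    [ChartedSpace (EuclideanSpace ℝ (Fin m)) N] [IsManifold (𝓡 m) ∞ N] :=
  Cₛ^∞⟮𝓡 m; EuclideanSpace ℝ (Fin m), (TangentSpace (𝓡 m) : N → Type _)⟯

section TensorCalculus

variable {m : ℕ} {N : Type*} [TopologicalSpace N]
  [ChartedSpace (EuclideanSpace ℝ (Fin m)) N]

/-- The Lie derivative of a two-covariant tensor `T` along `W`, evaluated on `X, Z`:
`(£_W T)(X, Z) = W(T(X, Z)) - T([W, X], Z) - T(X, [W, Z])`. -/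
def lieDerivTensor (W : ∀ p : N, TangentSpace (𝓡 m) p)
    (T : ∀ p : N, TangentSpace (𝓡 m) p →L[ℝ] TangentSpace (𝓡 m) p →L[ℝ] ℝ)
    (X Z : ∀ p : N, TangentSpace (𝓡 m) p) (p : N) : ℝ :=
  mvfderiv (𝓡 m) (fun q => T q (X q) (Z q)) p (W p)
    - T p (VectorField.mlieBracket (𝓡 m) W X p) (Z p)
    - T p (X p) (VectorField.mlieBracket (𝓡 m) W Z p)

/-- The symmetrized tensor product `α ⊗ₛ β = (α ⊗ β + β ⊗ α) / 2` of two covectors,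
evaluated on `v, w`. -/
def symProd {V : Type*} [AddCommGroup V] [Module ℝ V] [TopologicalSpace V]
    (α β : V →L[ℝ] ℝ) (v w : V) : ℝ :=
  (1 / 2) * (α v * β w + β v * α w)

end TensorCalculus

namespace MetricHypersurfaceData

variable {m : ℕ} {N : Type*} [TopologicalSpace N]
  [ChartedSpace (EuclideanSpace ℝ (Fin m)) N] [IsManifold (𝓡 m) ∞ N]
  (D : MetricHypersurfaceData m N)

/-- The tensor `𝒜` at `p`. -/
def form (p : N) : LinearMap.BilinForm ℝ (TangentSpace (𝓡 m) p × ℝ) :=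
  ambientForm (D.γ p) (D.ℓ p) (D.ℓ₂ p)

/-- The contravariant tensor `𝒜♯` at `p`, inverse to `𝒜`, as the map that sends a covector `Φ`
on `T_p N × ℝ` to the vector `𝒜♯(Φ, ·)`, i.e. the unique `v` with `𝒜(v, ·) = Φ`. -/
def sharp (p : N) :
    Module.Dual ℝ (TangentSpace (𝓡 m) p × ℝ) ≃ₗ[ℝ] TangentSpace (𝓡 m) p × ℝ :=
  haveI : FiniteDimensional ℝ (TangentSpace (𝓡 m) p) :=
    inferInstanceAs (FiniteDimensional ℝ (EuclideanSpace ℝ (Fin m)))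
  ((D.form p).toDual (D.nondegenerate p)).symm

/-- The vector field `n`, given by `β(n) = 𝒜♯((0, 1), (β, 0))`. -/
def n (p : N) : TangentSpace (𝓡 m) p :=
  (D.sharp p (LinearMap.snd ℝ (TangentSpace (𝓡 m) p) ℝ)).1

/-- The function `n⁽²⁾ = 𝒜♯((0, 1), (0, 1))`. -/
def n₂ (p : N) : ℝ :=
  (D.sharp p (LinearMap.snd ℝ (TangentSpace (𝓡 m) p) ℝ)).2

theorem form_n (p : N) (x : TangentSpace (𝓡 m) p × ℝ) : D.form p (D.n p, D.n₂ p) x = x.2 := by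
  have : FiniteDimensional ℝ (TangentSpace (𝓡 m) p) :=
    inferInstanceAs (FiniteDimensional ℝ (EuclideanSpace ℝ (Fin m)))
  exact LinearMap.BilinForm.apply_toDual_symm_apply (hB := D.nondegenerate p) _ x

/-- `γ(n, ·) + n⁽²⁾ ℓ = 0`. -/
theorem γ_n (p : N) (v : TangentSpace (𝓡 m) p) :
    D.γ p (D.n p) v + D.n₂ p * D.ℓ p v = 0 := by
  simpa [form, ambientForm] using D.form_n p (v, 0)

/-- `ℓ(n) + n⁽²⁾ ℓ⁽²⁾ = 1`. -/
theorem ℓ_n (p : N) : D.ℓ p (D.n p) + D.n₂ p * D.ℓ₂ p = 1 := by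
  simpa [form, ambientForm] using D.form_n p (0, 1)

/-- The tensor `U = (1/2) £_n γ + ℓ ⊗ₛ d n⁽²⁾`, evaluated on `X, Z`. -/
def U (X Z : ∀ p : N, TangentSpace (𝓡 m) p) (p : N) : ℝ :=
  (1 / 2) * lieDerivTensor D.n D.γ X Z p
    + symProd (D.ℓ p) (mvfderiv (𝓡 m) D.n₂ p) (X p) (Z p)

/-- `∇` is a metric hypersurface connection of `D`: a smooth torsion-free connection with
`(∇_X γ)(Z, W) = - U(X, Z) ℓ(W) - U(X, W) ℓ(Z)` and
`(∇_X ℓ)(Z) + (∇_Z ℓ)(X) = - 2 ℓ⁽²⁾ U(X, Z)`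
for all smooth vector fields `X, Z, W`. Here `∇_X Z` at `p` is `cov Z p (X p)`. -/
structure IsConnection
    (cov : CovariantDerivative (𝓡 m) (EuclideanSpace ℝ (Fin m))
      (TangentSpace (𝓡 m) : N → Type _)) : Prop where
  smooth : cov.ContMDiffCovariantDerivative ∞
  torsion_free : ∀ p : N, cov.torsion p = 0
  deriv_γ : ∀ (X Z W : SmoothVectorField m N) (p : N),
    mvfderiv (𝓡 m) (fun q => D.γ q (Z q) (W q)) p (X p)
        - D.γ p (cov Z p (X p)) (W p) - D.γ p (Z p) (cov W p (X p))
      = - D.U X Z p * D.ℓ p (W p) - D.U X W p * D.ℓ p (Z p)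
  deriv_ℓ : ∀ (X Z : SmoothVectorField m N) (p : N),
    (mvfderiv (𝓡 m) (fun q => D.ℓ q (Z q)) p (X p) - D.ℓ p (cov Z p (X p)))
        + (mvfderiv (𝓡 m) (fun q => D.ℓ q (X q)) p (Z p) - D.ℓ p (cov X p (Z p)))
      = - 2 * D.ℓ₂ p * D.U X Z p

/-- The gauge transformed data: `γ ↦ γ`, `ℓ ↦ u (ℓ + γ(ζ, ·))`,
`ℓ⁽²⁾ ↦ u² (ℓ⁽²⁾ + 2 ℓ(ζ) + γ(ζ, ζ))`. -/
def gauge (u : C^∞⟮𝓡 m, N; 𝓘(ℝ, ℝ), ℝ⟯) (hu : ∀ p, u p ≠ 0) (ζ : SmoothVectorField m N) :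
    MetricHypersurfaceData m N where
  γ := D.γ
  ℓ p := u p • (D.ℓ p + D.γ p (ζ p))
  ℓ₂ p := u p ^ 2 * (D.ℓ₂ p + 2 * D.ℓ p (ζ p) + D.γ p (ζ p) (ζ p))
  symm := D.symm
  smooth_γ := D.smooth_γ
  smooth_ℓ :=
    u.contMDiff.smul_section
      (D.smooth_ℓ.add_section (D.smooth_γ.clm_bundle_apply ζ.contMDiff))
  smooth_ℓ₂ := by
    have h1 : ContMDiff (𝓡 m) 𝓘(ℝ, ℝ) ∞ (fun p => D.ℓ p (ζ p)) := by
      have h := D.smooth_ℓ.clm_bundle_apply (E₂ := Bundle.Trivial N ℝ) ζ.contMDiff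
      intro p
      have hp := h p
      simp only [Bundle.contMDiffAt_section] at hp
      exact hp
    have h2 : ContMDiff (𝓡 m) 𝓘(ℝ, ℝ) ∞ (fun p => D.γ p (ζ p) (ζ p)) := by
      have h := D.smooth_γ.clm_bundle_apply₂ (E₃ := Bundle.Trivial N ℝ) ζ.contMDiff ζ.contMDiff
      intro p
      have hp := h p
      simp only [Bundle.contMDiffAt_section] at hp
      exact hp
    exact (u.contMDiff.pow 2).mul
      ((D.smooth_ℓ₂.add (contMDiff_const.mul h1)).add h2)
  nondegenerate p := ambientForm_gauge_nondegenerate _ _ _ (D.symm p) (hu p) _ (D.nondegenerate p)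

end MetricHypersurfaceData

end

/-! Think of `(W, a)` as the ambient vector `W + a ξ` along a hypersurface with rigging `ξ`. The two
defining equations together with vanishing torsion say exactly that `(∇_X Z, -U(X, Z))` is the
`𝒜`-dual of the covector `(W, b) ↦ koszul(X, Z, W) + b koszulℓ(X, Z)`; this is `IsKoszulVector`.
Since `𝒜` is non-degenerate, such a vector exists and is unique, hence so does the connection
(`isConnection_connection`, `IsConnection.difference_eq_zero`). That the second component must be
`-U` follows by pairing with `(n, n⁽²⁾)`, see `koszul_n`.

A gauge change replaces `ξ` by `u(ξ + ζ)`, so `φ(W, a) = (W + uaζ, ua)` is an isometry from the new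
`𝒜` to the old one (`form_gauge`). The tangential Koszul expression does not change, and the
transverse one picks up `T/2` with `T = £_{uζ}γ + 2 ℓ ⊗ₛ du` (`koszulℓ_gauge`). Therefore `φ` sends
the new Koszul vector to the old one plus `T/(2u) · (n, n⁽²⁾)` (`IsKoszulVector.gauge`), and the two
components of this identity give the difference tensor. -/

noncomputable section

open Bundle VectorField Filter Topology

/-! ### Smoothness criteria and global extension of vectors -/

section SmoothCalculus

variable {m : ℕ} {N : Type*} [TopologicalSpace N]
  [ChartedSpace (EuclideanSpace ℝ (Fin m)) N]

/-- The function `f` is smooth at `p`. -/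
abbrev SmoothFunAt (m : ℕ) {N : Type*} [TopologicalSpace N]
    [ChartedSpace (EuclideanSpace ℝ (Fin m)) N] (f : N → ℝ) (p : N) : Prop :=
  ContMDiffAt (𝓡 m) 𝓘(ℝ, ℝ) ∞ f p

/-- The vector field `X` is smooth at `p`. -/
abbrev SmoothFieldAt [IsManifold (𝓡 m) ∞ N] (X : ∀ p : N, TangentSpace (𝓡 m) p) (p : N) : Prop :=
  ContMDiffAt (𝓡 m) ((𝓡 m).prod 𝓘(ℝ, EuclideanSpace ℝ (Fin m))) ∞
    (fun q => TotalSpace.mk' (EuclideanSpace ℝ (Fin m)) q (X q)) p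

/-- The function `f` is differentiable at `p`. -/
abbrev DiffFunAt (m : ℕ) {N : Type*} [TopologicalSpace N]
    [ChartedSpace (EuclideanSpace ℝ (Fin m)) N] (f : N → ℝ) (p : N) : Prop :=
  MDifferentiableAt (𝓡 m) 𝓘(ℝ, ℝ) f p

/-- The vector field `X` is differentiable at `p`. -/
abbrev DiffFieldAt [IsManifold (𝓡 m) ∞ N] (X : ∀ p : N, TangentSpace (𝓡 m) p) (p : N) : Prop :=
  MDifferentiableAt (𝓡 m) ((𝓡 m).prod 𝓘(ℝ, EuclideanSpace ℝ (Fin m)))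
    (fun q => TotalSpace.mk' (EuclideanSpace ℝ (Fin m)) q (X q)) p

theorem contMDiffAt_det {ι : Type*} [Fintype ι] [DecidableEq ι] {G : N → Matrix ι ι ℝ} {p : N}
    (hG : ∀ i j, SmoothFunAt m (fun q => G q i j) p) :
    SmoothFunAt m (fun q => (G q).det) p := by
  simp only [Matrix.det_apply]
  refine contMDiffAt_finsetSum fun σ _ => ?_
  simp only [Units.smul_def, zsmul_eq_mul]
  exact contMDiffAt_const.mul (contMDiffAt_finsetProd fun i _ => hG _ _)

/-- Cramer's rule: `c = det(G)⁻¹ (c G) adj(G)` wherever `det G ≠ 0`, which by continuity is a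
neighbourhood of `p`. -/
theorem contMDiffAt_of_vecMul {ι : Type*} [Fintype ι] [DecidableEq ι] {G : N → Matrix ι ι ℝ}
    {c : N → ι → ℝ} {p : N} (hG : ∀ i j, SmoothFunAt m (fun q => G q i j) p)
    (hdet : (G p).det ≠ 0)
    (hc : ∀ j, SmoothFunAt m (fun q => Matrix.vecMul (c q) (G q) j) p) (i : ι) :
    SmoothFunAt m (fun q => c q i) p := by
  have hd := contMDiffAt_det hG
  have hadj : ∀ i j, SmoothFunAt m (fun q => (G q).adjugate i j) p := fun i j => by
    simp only [Matrix.adjugate_apply]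
    refine contMDiffAt_det fun k l => ?_
    by_cases hk : k = j
    · subst hk; simpa only [Matrix.updateRow_self] using contMDiffAt_const
    · simpa [Matrix.updateRow_ne hk] using hG k l
  have h : SmoothFunAt m (fun q => ((G q).det)⁻¹ *
      ∑ j, Matrix.vecMul (c q) (G q) j * (G q).adjugate j i) p :=
    (hd.inv₀ hdet).mul (contMDiffAt_finsetSum fun j _ => (hc j).mul (hadj j i))
  refine h.congr_of_eventuallyEq ?_
  filter_upwards [hd.continuousAt.eventually_ne hdet] with q hq
  have : Matrix.vecMul (Matrix.vecMul (c q) (G q)) (G q).adjugate = (G q).det • c q := by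
    rw [Matrix.vecMul_vecMul, Matrix.mul_adjugate, Matrix.vecMul_smul, Matrix.vecMul_one]
  have h2 := congrFun this i
  rw [Matrix.vecMul, dotProduct] at h2
  simp only [h2, Pi.smul_apply, smul_eq_mul, inv_mul_cancel_left₀ hq]

variable [IsManifold (𝓡 m) ∞ N]

theorem contMDiffAt_mvfderiv_apply {f : N → ℝ} {X : ∀ p : N, TangentSpace (𝓡 m) p} {p : N}
    (hf : SmoothFunAt m f p) (hX : SmoothFieldAt X p) :
    SmoothFunAt m (fun q => mvfderiv (𝓡 m) f q (X q)) p := by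
  have : IsManifold (𝓡 m) 1 N := .of_le (n := ∞) (by simp)
  have h1 := ContMDiffAt.mfderiv_const (I := 𝓡 m) (I' := 𝓘(ℝ, ℝ)) (m := ∞) hf (by simp)
  have h2 := ContMDiffAt.clm_apply_of_inCoordinates (F₁ := EuclideanSpace ℝ (Fin m))
    (F₂ := ℝ) (E₁ := (TangentSpace (𝓡 m) : N → Type _))
    (E₂ := (TangentSpace 𝓘(ℝ, ℝ) : ℝ → Type _)) (b₁ := id) (b₂ := f) (m₀ := p)
    (ϕ := fun q => mfderiv (𝓡 m) 𝓘(ℝ, ℝ) f q) (v := X) h1 hX hf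
  exact (contMDiff_snd_tangentBundle_modelSpace ℝ 𝓘(ℝ, ℝ)).contMDiffAt.comp p h2

theorem contMDiffAt_mlieBracket {X Y : ∀ p : N, TangentSpace (𝓡 m) p} {p : N}
    (hX : SmoothFieldAt X p) (hY : SmoothFieldAt Y p) :
    SmoothFieldAt (mlieBracket (𝓡 m) X Y) p := by
  have : IsManifold (𝓡 m) ((⊤ : ℕ∞) + 1 : WithTop ℕ∞) N := by simpa
  have : IsManifold (𝓡 m) (minSmoothness ℝ 2) N :=
    .of_le (n := ∞) (by simpa using WithTop.coe_le_coe.2 (le_top : (2 : ℕ∞) ≤ ⊤))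
  exact ContMDiffAt.mlieBracket_vectorField (m := ⊤) (n := ⊤) hX hY (by simp)

/-- A local extension is cut off by a bump function. Uniqueness needs this because `IsConnection`
only tests global smooth fields. -/
theorem exists_smoothVectorField_apply_eq [T2Space N] {p : N} (v : TangentSpace (𝓡 m) p) :
    ∃ X : SmoothVectorField m N, X p = v := by
  let E := EuclideanSpace ℝ (Fin m)
  let e := trivializationAt E (TangentSpace (𝓡 m) : N → Type _) p
  have he : e.baseSet = (chartAt E p).source := rfl
  let f : SmoothBumpFunction (𝓡 m) p := Classical.arbitrary _
  have hs : ContMDiffOn (𝓡 m) ((𝓡 m).prod 𝓘(ℝ, E)) ∞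
      (fun q => TotalSpace.mk' E q (FiberBundle.extend E v q)) e.baseSet := by
    intro x hx
    rw [e.contMDiffWithinAt_section _ hx]
    have : ContMDiffOn (𝓡 m) 𝓘(ℝ, E) ∞ (fun _ : N => (e ⟨p, v⟩).2) e.baseSet :=
      contMDiffOn_const
    exact this.congr (fun x hx => by
      simp only [FiberBundle.extend]; rw [e.apply_mk_symm hx]) x hx
  refine ⟨⟨fun q => f q • FiberBundle.extend E v q, ?_⟩, ?_⟩
  · exact ContMDiffOn.smul_section_of_tsupport (ψ := f) f.contMDiff.contMDiffOn
      e.open_baseSet (by rw [he]; exact f.tsupport_subset_chartAt_source) hs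
  · change f p • FiberBundle.extend E v p = v
    simp

theorem contMDiffAt_hom_of_apply
    {φ : ∀ q : N, TangentSpace (𝓡 m) q →L[ℝ] TangentSpace (𝓡 m) q} {p : N}
    (h : ∀ X : ∀ q : N, TangentSpace (𝓡 m) q, SmoothFieldAt X p →
      SmoothFieldAt (fun q => φ q (X q)) p) :
    ContMDiffAt (𝓡 m)
      ((𝓡 m).prod 𝓘(ℝ, EuclideanSpace ℝ (Fin m) →L[ℝ] EuclideanSpace ℝ (Fin m))) ∞
      (fun q => TotalSpace.mk' (EuclideanSpace ℝ (Fin m) →L[ℝ] EuclideanSpace ℝ (Fin m))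
        (E := fun q : N => TangentSpace (𝓡 m) q →L[ℝ] TangentSpace (𝓡 m) q) q (φ q)) p := by
  let E := EuclideanSpace ℝ (Fin m)
  let e := trivializationAt E (TangentSpace (𝓡 m) : N → Type _) p
  have hp : p ∈ e.baseSet := FiberBundle.mem_baseSet_trivializationAt' p
  let b := (EuclideanSpace.basisFun (Fin m) ℝ).toBasis
  rw [contMDiffAt_hom_bundle]
  refine ⟨contMDiffAt_id, ?_⟩
  have key : ∀ i, ContMDiffAt (𝓡 m) 𝓘(ℝ, E) ∞
      (fun q => (e ⟨q, φ q (e.localFrame b i q)⟩).2) p := fun i =>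
    (contMDiffAt_section p).1 (h _ (contMDiffAt_localFrame_of_mem ∞ e b i hp))
  -- In the trivialization `φ` is the sum of dual basis covectors tensored with the images of the
  -- frame fields.
  have hsum : ContMDiffAt (𝓡 m) 𝓘(ℝ, E →L[ℝ] E) ∞
      (fun q => ∑ i, (LinearMap.toContinuousLinearMap (b.coord i)).smulRight
      ((e ⟨q, φ q (e.localFrame b i q)⟩).2) : N → E →L[ℝ] E) p := by
    refine contMDiffAt_finsetSum fun i _ => ?_
    exact (ContinuousLinearMap.contMDiff (ContinuousLinearMap.smulRightL ℝ E E
      (LinearMap.toContinuousLinearMap (b.coord i)))).contMDiffAt.comp p (key i)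
  refine hsum.congr_of_eventuallyEq ?_
  filter_upwards [e.open_baseSet.mem_nhds hp] with q hq
  refine ContinuousLinearMap.coe_injective (b.ext fun j => ?_)
  rw [ContinuousLinearMap.inCoordinates_eq hq hq]
  simp [Finset.sum_apply, Bundle.Trivialization.basisAt, hq, Finsupp.single_apply]
  rfl

end SmoothCalculus

namespace MetricHypersurfaceData

variable {m : ℕ} {N : Type*} [TopologicalSpace N]
  [ChartedSpace (EuclideanSpace ℝ (Fin m)) N] [IsManifold (𝓡 m) ∞ N]
  (D : MetricHypersurfaceData m N)

/-! ### Calculus of `γ(X, Y)` and `ℓ(X)` -/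

section Pairing

variable {X Y Z : ∀ p : N, TangentSpace (𝓡 m) p} {f : N → ℝ} {p : N}

theorem smooth_γ_apply (hX : SmoothFieldAt X p) (hY : SmoothFieldAt Y p) :
    SmoothFunAt m (fun q => D.γ q (X q) (Y q)) p := by
  have h := (D.smooth_γ p).clm_bundle_apply₂ (E₃ := Bundle.Trivial N ℝ) hX hY
  simp only [Bundle.contMDiffAt_section] at h
  exact h

theorem smooth_ℓ_apply (hX : SmoothFieldAt X p) :
    SmoothFunAt m (fun q => D.ℓ q (X q)) p := by
  have h := (D.smooth_ℓ p).clm_bundle_apply (E₂ := Bundle.Trivial N ℝ) hX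
  simp only [Bundle.contMDiffAt_section] at h
  exact h

theorem diff_γ_apply (hX : DiffFieldAt X p) (hY : DiffFieldAt Y p) :
    DiffFunAt m (fun q => D.γ q (X q) (Y q)) p := by
  have h := ((D.smooth_γ p).mdifferentiableAt (by simp)).clm_bundle_apply₂
    (E₃ := Bundle.Trivial N ℝ) hX hY
  simp only [mdifferentiableAt_section] at h
  exact h

theorem diff_ℓ_apply (hX : DiffFieldAt X p) :
    DiffFunAt m (fun q => D.ℓ q (X q)) p := by
  have h := ((D.smooth_ℓ p).mdifferentiableAt (by simp)).clm_bundle_apply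
    (E₂ := Bundle.Trivial N ℝ) hX
  simp only [mdifferentiableAt_section] at h
  exact h

theorem mvfderiv_γ_comm : mvfderiv (𝓡 m) (fun q => D.γ q (X q) (Y q)) p =
    mvfderiv (𝓡 m) (fun q => D.γ q (Y q) (X q)) p := by
  simp only [D.symm _ (X _)]

theorem mvfderiv_γ_add_left (hX : DiffFieldAt X p) (hY : DiffFieldAt Y p)
    (hZ : DiffFieldAt Z p) (v : TangentSpace (𝓡 m) p) :
    mvfderiv (𝓡 m) (fun q => D.γ q ((X + Y) q) (Z q)) p v =
      mvfderiv (𝓡 m) (fun q => D.γ q (X q) (Z q)) p v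
        + mvfderiv (𝓡 m) (fun q => D.γ q (Y q) (Z q)) p v := by
  simp only [Pi.add_apply, map_add, _root_.add_apply]
  rw [mvfderiv_fun_add (D.diff_γ_apply hX hZ) (D.diff_γ_apply hY hZ),
    _root_.add_apply]

theorem mvfderiv_γ_add_right (hX : DiffFieldAt X p) (hY : DiffFieldAt Y p)
    (hZ : DiffFieldAt Z p) (v : TangentSpace (𝓡 m) p) :
    mvfderiv (𝓡 m) (fun q => D.γ q (Z q) ((X + Y) q)) p v =
      mvfderiv (𝓡 m) (fun q => D.γ q (Z q) (X q)) p v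
        + mvfderiv (𝓡 m) (fun q => D.γ q (Z q) (Y q)) p v := by
  simp only [D.mvfderiv_γ_comm (X := Z), D.mvfderiv_γ_add_left hX hY hZ]

theorem mvfderiv_γ_smul_left (hf : DiffFunAt m f p) (hX : DiffFieldAt X p)
    (hZ : DiffFieldAt Z p) (v : TangentSpace (𝓡 m) p) :
    mvfderiv (𝓡 m) (fun q => D.γ q ((f • X) q) (Z q)) p v =
      f p * mvfderiv (𝓡 m) (fun q => D.γ q (X q) (Z q)) p v
        + D.γ p (X p) (Z p) * mvfderiv (𝓡 m) f p v := by
  simp only [Pi.smul_apply', map_smul, _root_.smul_apply, smul_eq_mul]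
  rw [mvfderiv_fun_mul hf (D.diff_γ_apply hX hZ)]
  simp

theorem mvfderiv_γ_smul_right (hf : DiffFunAt m f p) (hX : DiffFieldAt X p)
    (hZ : DiffFieldAt Z p) (v : TangentSpace (𝓡 m) p) :
    mvfderiv (𝓡 m) (fun q => D.γ q (Z q) ((f • X) q)) p v =
      f p * mvfderiv (𝓡 m) (fun q => D.γ q (Z q) (X q)) p v
        + D.γ p (Z p) (X p) * mvfderiv (𝓡 m) f p v := by
  rw [mvfderiv_γ_comm, D.mvfderiv_γ_smul_left hf hX hZ, mvfderiv_γ_comm, D.symm p (Z p)]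

theorem mvfderiv_ℓ_add (hX : DiffFieldAt X p) (hY : DiffFieldAt Y p)
    (v : TangentSpace (𝓡 m) p) :
    mvfderiv (𝓡 m) (fun q => D.ℓ q ((X + Y) q)) p v =
      mvfderiv (𝓡 m) (fun q => D.ℓ q (X q)) p v
        + mvfderiv (𝓡 m) (fun q => D.ℓ q (Y q)) p v := by
  simp only [Pi.add_apply, map_add]
  rw [mvfderiv_fun_add (D.diff_ℓ_apply hX) (D.diff_ℓ_apply hY), _root_.add_apply]

theorem mvfderiv_ℓ_smul (hf : DiffFunAt m f p) (hX : DiffFieldAt X p)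
    (v : TangentSpace (𝓡 m) p) :
    mvfderiv (𝓡 m) (fun q => D.ℓ q ((f • X) q)) p v =
      f p * mvfderiv (𝓡 m) (fun q => D.ℓ q (X q)) p v
        + D.ℓ p (X p) * mvfderiv (𝓡 m) f p v := by
  simp only [Pi.smul_apply', map_smul, smul_eq_mul]
  rw [mvfderiv_fun_mul hf (D.diff_ℓ_apply hX)]
  simp

end Pairing

/-! ### Koszul expressions and their behaviour in each slot -/

section Koszul

/-- The Koszul expression of `γ`: for a metric connection it would be `γ(∇_X Z, W)`. -/
def koszul (X Z W : ∀ p : N, TangentSpace (𝓡 m) p) (p : N) : ℝ :=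
  (1 / 2) * (mvfderiv (𝓡 m) (fun q => D.γ q (Z q) (W q)) p (X p)
    + mvfderiv (𝓡 m) (fun q => D.γ q (X q) (W q)) p (Z p)
    - mvfderiv (𝓡 m) (fun q => D.γ q (X q) (Z q)) p (W p)
    + D.γ p (mlieBracket (𝓡 m) X Z p) (W p)
    - D.γ p (mlieBracket (𝓡 m) X W p) (Z p)
    - D.γ p (mlieBracket (𝓡 m) Z W p) (X p))

/-- The Koszul expression in the transverse direction,
`(X(ℓ(Z)) + Z(ℓ(X)) + ℓ([X, Z])) / 2`. -/
def koszulℓ (X Z : ∀ p : N, TangentSpace (𝓡 m) p) (p : N) : ℝ :=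
  (1 / 2) * (mvfderiv (𝓡 m) (fun q => D.ℓ q (Z q)) p (X p)
    + mvfderiv (𝓡 m) (fun q => D.ℓ q (X q)) p (Z p)
    + D.ℓ p (mlieBracket (𝓡 m) X Z p))

variable {X X' Z Z' W W' : ∀ p : N, TangentSpace (𝓡 m) p} {f : N → ℝ} {p : N}

theorem koszul_add_left (hX : DiffFieldAt X p) (hX' : DiffFieldAt X' p) (hZ : DiffFieldAt Z p)
    (hW : DiffFieldAt W p) :
    D.koszul (X + X') Z W p = D.koszul X Z W p + D.koszul X' Z W p := by
  simp only [koszul, D.mvfderiv_γ_add_left hX hX' hZ, D.mvfderiv_γ_add_left hX hX' hW,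
    mlieBracket_add_left hX hX']
  simp only [Pi.add_apply, map_add, _root_.add_apply]
  ring

theorem koszul_add_middle (hX : DiffFieldAt X p) (hZ : DiffFieldAt Z p)
    (hZ' : DiffFieldAt Z' p) (hW : DiffFieldAt W p) :
    D.koszul X (Z + Z') W p = D.koszul X Z W p + D.koszul X Z' W p := by
  simp only [koszul, D.mvfderiv_γ_add_left hZ hZ' hW, D.mvfderiv_γ_add_right hZ hZ' hX,
    mlieBracket_add_left hZ hZ', mlieBracket_add_right hZ hZ']
  simp only [Pi.add_apply, map_add,
    _root_.add_apply]
  ring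

theorem koszul_add_right (hX : DiffFieldAt X p) (hZ : DiffFieldAt Z p)
    (hW : DiffFieldAt W p) (hW' : DiffFieldAt W' p) :
    D.koszul X Z (W + W') p = D.koszul X Z W p + D.koszul X Z W' p := by
  simp only [koszul, D.mvfderiv_γ_add_right hW hW' hX, D.mvfderiv_γ_add_right hW hW' hZ,
    mlieBracket_add_right hW hW']
  simp only [Pi.add_apply, map_add, _root_.add_apply]
  ring

theorem koszul_smul_left (hf : DiffFunAt m f p) (hX : DiffFieldAt X p) (hZ : DiffFieldAt Z p)
    (hW : DiffFieldAt W p) :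
    D.koszul (f • X) Z W p = f p * D.koszul X Z W p := by
  simp only [koszul, D.mvfderiv_γ_smul_left hf hX hZ, D.mvfderiv_γ_smul_left hf hX hW,
    mlieBracket_smul_left hf hX]
  simp only [Pi.smul_apply', map_add, map_smul, map_neg, _root_.add_apply, _root_.smul_apply,
    _root_.neg_apply, smul_eq_mul, neg_smul]
  ring

/-- In the other two slots the derivatives of `f` cancel against those from the brackets; here one
term survives, and it becomes the Leibniz rule of the connection. -/
theorem koszul_smul_middle (hf : DiffFunAt m f p) (hX : DiffFieldAt X p) (hZ : DiffFieldAt Z p)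
    (hW : DiffFieldAt W p) :
    D.koszul X (f • Z) W p =
      f p * D.koszul X Z W p + mvfderiv (𝓡 m) f p (X p) * D.γ p (Z p) (W p) := by
  simp only [koszul, D.mvfderiv_γ_smul_left hf hZ hW, D.mvfderiv_γ_smul_right hf hZ hX,
    mlieBracket_smul_left hf hZ, mlieBracket_smul_right hf hZ]
  simp only [Pi.smul_apply', map_add, map_smul, map_neg, _root_.add_apply, _root_.smul_apply,
    _root_.neg_apply, smul_eq_mul, neg_smul, D.symm p (Z p) (X p)]
  ring

theorem koszul_smul_right (hf : DiffFunAt m f p) (hX : DiffFieldAt X p) (hZ : DiffFieldAt Z p)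
    (hW : DiffFieldAt W p) :
    D.koszul X Z (f • W) p = f p * D.koszul X Z W p := by
  simp only [koszul, D.mvfderiv_γ_smul_right hf hW hX, D.mvfderiv_γ_smul_right hf hW hZ,
    mlieBracket_smul_right hf hW]
  simp only [Pi.smul_apply', map_add, map_smul, _root_.add_apply, _root_.smul_apply,
    smul_eq_mul, D.symm p (W p)]
  ring

/-- Source of the vanishing torsion, together with `koszulℓ_sub_swap`. -/
theorem koszul_sub_swap : D.koszul X Z W p - D.koszul Z X W p =
    D.γ p (mlieBracket (𝓡 m) X Z p) (W p) := by
  simp only [koszul, mlieBracket_swap_apply (V := Z) (W := X), map_neg,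
    _root_.neg_apply, D.mvfderiv_γ_comm (X := Z) (Y := X)]
  ring

theorem koszulℓ_add_left (hX : DiffFieldAt X p) (hX' : DiffFieldAt X' p) :
    D.koszulℓ (X + X') Z p = D.koszulℓ X Z p + D.koszulℓ X' Z p := by
  simp only [koszulℓ, D.mvfderiv_ℓ_add hX hX', mlieBracket_add_left hX hX']
  simp only [Pi.add_apply, map_add]
  ring

theorem koszulℓ_add_right (hZ : DiffFieldAt Z p) (hZ' : DiffFieldAt Z' p) :
    D.koszulℓ X (Z + Z') p = D.koszulℓ X Z p + D.koszulℓ X Z' p := by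
  simp only [koszulℓ, D.mvfderiv_ℓ_add hZ hZ', mlieBracket_add_right hZ hZ']
  simp only [Pi.add_apply, map_add]
  ring

theorem koszulℓ_smul_left (hf : DiffFunAt m f p) (hX : DiffFieldAt X p) :
    D.koszulℓ (f • X) Z p = f p * D.koszulℓ X Z p := by
  simp only [koszulℓ, D.mvfderiv_ℓ_smul hf hX, mlieBracket_smul_left hf hX]
  simp only [Pi.smul_apply',
    map_add, map_smul, map_neg, smul_eq_mul, neg_smul]
  ring

theorem koszulℓ_smul_right (hf : DiffFunAt m f p) (hZ : DiffFieldAt Z p) :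
    D.koszulℓ X (f • Z) p =
      f p * D.koszulℓ X Z p + mvfderiv (𝓡 m) f p (X p) * D.ℓ p (Z p) := by
  simp only [koszulℓ, D.mvfderiv_ℓ_smul hf hZ, mlieBracket_smul_right hf hZ]
  simp only [Pi.smul_apply',
    map_add, map_smul, smul_eq_mul]
  ring

theorem koszulℓ_sub_swap : D.koszulℓ X Z p - D.koszulℓ Z X p =
    D.ℓ p (mlieBracket (𝓡 m) X Z p) := by
  simp only [koszulℓ, mlieBracket_swap_apply (V := Z) (W := X), map_neg]
  ring

theorem smooth_koszul (hX : SmoothFieldAt X p) (hZ : SmoothFieldAt Z p) (hW : SmoothFieldAt W p) :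
    SmoothFunAt m (D.koszul X Z W) p := by
  refine contMDiffAt_const.mul (((((?_ : ContMDiffAt _ _ _ _ _).add ?_).sub ?_).add ?_).sub ?_
    |>.sub ?_)
  · exact contMDiffAt_mvfderiv_apply (D.smooth_γ_apply hZ hW) hX
  · exact contMDiffAt_mvfderiv_apply (D.smooth_γ_apply hX hW) hZ
  · exact contMDiffAt_mvfderiv_apply (D.smooth_γ_apply hX hZ) hW
  · exact D.smooth_γ_apply (contMDiffAt_mlieBracket hX hZ) hW
  · exact D.smooth_γ_apply (contMDiffAt_mlieBracket hX hW) hZ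
  · exact D.smooth_γ_apply (contMDiffAt_mlieBracket hZ hW) hX

theorem smooth_koszulℓ (hX : SmoothFieldAt X p) (hZ : SmoothFieldAt Z p) :
    SmoothFunAt m (D.koszulℓ X Z) p :=
  contMDiffAt_const.mul (((contMDiffAt_mvfderiv_apply (D.smooth_ℓ_apply hZ) hX).add
    (contMDiffAt_mvfderiv_apply (D.smooth_ℓ_apply hX) hZ)).add
    (D.smooth_ℓ_apply (contMDiffAt_mlieBracket hX hZ)))

end Koszul

/-! ### Vectors determined by their pairings with `𝒜` -/

section Form

theorem form_apply (p : N) (x y : TangentSpace (𝓡 m) p × ℝ) :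
    D.form p x y = D.γ p x.1 y.1 + x.2 * D.ℓ p y.1 + y.2 * D.ℓ p x.1 + x.2 * y.2 * D.ℓ₂ p :=
  rfl

theorem eq_of_form_eq {p : N} {x y : TangentSpace (𝓡 m) p × ℝ}
    (h : ∀ z, D.form p x z = D.form p y z) : x = y :=
  sub_eq_zero.1 ((D.nondegenerate p).1 _ fun z => by
    change D.form p (x - y) z = 0
    rw [map_sub, LinearMap.sub_apply, h, sub_self])

theorem form_sharp (p : N) (Φ : Module.Dual ℝ (TangentSpace (𝓡 m) p × ℝ))
    (x : TangentSpace (𝓡 m) p × ℝ) : D.form p (D.sharp p Φ) x = Φ x := by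
  have : FiniteDimensional ℝ (TangentSpace (𝓡 m) p) :=
    inferInstanceAs (FiniteDimensional ℝ (EuclideanSpace ℝ (Fin m)))
  exact LinearMap.BilinForm.apply_toDual_symm_apply (hB := D.nondegenerate p) _ x

/-- In a local frame completed by `(0, 1)`, the coefficients of `(V, a)` times the Gram matrix of
`𝒜` are the given smooth pairings. The Gram matrix is smooth and invertible at `p`, so
`contMDiffAt_of_vecMul` applies. -/
theorem smooth_of_form {V : ∀ p : N, TangentSpace (𝓡 m) p} {a : N → ℝ} {p : N}
    (h₁ : ∀ W : ∀ p : N, TangentSpace (𝓡 m) p, SmoothFieldAt W p →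
      SmoothFunAt m (fun q => D.form q (V q, a q) (W q, 0)) p)
    (h₂ : SmoothFunAt m (fun q => D.form q (V q, a q) (0, 1)) p) :
    SmoothFieldAt V p ∧ SmoothFunAt m a p := by
  let E := EuclideanSpace ℝ (Fin m)
  let e := trivializationAt E (TangentSpace (𝓡 m) : N → Type _) p
  have hp : p ∈ e.baseSet := FiberBundle.mem_baseSet_trivializationAt' p
  let b := (EuclideanSpace.basisFun (Fin m) ℝ).toBasis
  let F : Fin m ⊕ Unit → ∀ q : N, TangentSpace (𝓡 m) q × ℝ :=
    Sum.elim (fun i q => (e.localFrame b i q, 0)) (fun _ q => (0, 1))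
  let G : N → Matrix (Fin m ⊕ Unit) (Fin m ⊕ Unit) ℝ := fun q =>
    Matrix.of fun i j => D.form q (F i q) (F j q)
  let c : N → Fin m ⊕ Unit → ℝ := fun q =>
    Sum.elim (fun i => e.localFrameCoeff (𝓡 m) b i q (V q)) (fun _ => a q)
  have hs : ∀ i, SmoothFieldAt (e.localFrame b i) p :=
    fun i => contMDiffAt_localFrame_of_mem ∞ e b i hp
  have hG : ∀ i j, SmoothFunAt m (fun q => G q i j) p := by
    rintro (i | i) (j | j)
    · simpa [G, F, form_apply] using D.smooth_γ_apply (hs i) (hs j)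
    · simpa [G, F, form_apply] using D.smooth_ℓ_apply (hs i)
    · simpa [G, F, form_apply] using D.smooth_ℓ_apply (hs j)
    · simpa [G, F, form_apply] using D.smooth_ℓ₂ p
  have hdet : (G p).det ≠ 0 := by
    let B := (e.basisAt b hp).prod (Module.Basis.singleton Unit ℝ)
    have hB : ∀ i, B i = F i p := by
      rintro (i | i)
      · simp [B, F, hp]
      · simp [B, F]
    have h := (LinearMap.BilinForm.nondegenerate_iff_det_ne_zero (B := D.form p) B).1
      (D.nondegenerate p)
    convert h using 2
    ext i j
    simp [G, LinearMap.BilinForm.toMatrix_apply, hB]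
  have hc : ∀ j, SmoothFunAt m (fun q => Matrix.vecMul (c q) (G q) j) p := by
    have hcF : ∀ᶠ q in 𝓝 p, ∀ j, Matrix.vecMul (c q) (G q) j = D.form q (V q, a q) (F j q) := by
      filter_upwards [e.open_baseSet.mem_nhds hp] with q hq j
      have hV : (V q, a q) = ∑ i, c q i • F i q := by
        have := e.eq_sum_localFrameCoeff_smul (I := 𝓡 m) (b := b) (s := V) hq
        simp only [c, F, Fintype.sum_sum_type, Sum.elim_inl, Sum.elim_inr, Prod.smul_mk, smul_zero,
          Finset.univ_unique, Finset.sum_singleton, smul_eq_mul, mul_one]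
        refine Prod.ext ?_ ?_
        · simpa only [Prod.fst_add, Prod.fst_sum, add_zero] using this
        · simp [Prod.snd_sum]
      rw [hV]
      simp [Matrix.vecMul, dotProduct, G, LinearMap.sum_apply]
    rintro (j | j)
    · exact (h₁ _ (hs j)).congr_of_eventuallyEq (hcF.mono fun q hq => hq (.inl j))
    · exact h₂.congr_of_eventuallyEq (hcF.mono fun q hq => hq (.inr j))
  have key := contMDiffAt_of_vecMul hG hdet hc
  exact ⟨(contMDiffAt_iff_localFrameCoeff b hp).2 fun i => key (.inl i), key (.inr ())⟩

end Form

/-! ### The field `n`, Lie derivatives and the tensor `U` -/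

section Normal

theorem smooth_n_n₂ (p : N) : SmoothFieldAt D.n p ∧ SmoothFunAt m D.n₂ p := by
  refine D.smooth_of_form (fun W _ => ?_) ?_ <;> simp only [form_n] <;> exact contMDiffAt_const

theorem diff_n (p : N) : DiffFieldAt D.n p := (D.smooth_n_n₂ p).1.mdifferentiableAt (by simp)

theorem diff_n₂ (p : N) : DiffFunAt m D.n₂ p := (D.smooth_n_n₂ p).2.mdifferentiableAt (by simp)

variable {X Z V : ∀ p : N, TangentSpace (𝓡 m) p} {f : N → ℝ} {p : N}

theorem lieDerivTensor_comm :
    lieDerivTensor V D.γ X Z p = lieDerivTensor V D.γ Z X p := by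
  simp only [lieDerivTensor, D.mvfderiv_γ_comm (X := X), D.symm p (X p), D.symm p _ (Z p)]
  ring

theorem U_comm : D.U X Z p = D.U Z X p := by
  simp only [U, symProd, D.lieDerivTensor_comm (X := X) (Z := Z)]
  ring

theorem lieDerivTensor_smul (hf : DiffFunAt m f p) (hV : DiffFieldAt V p) :
    lieDerivTensor (fun q => f q • V q) D.γ X Z p = f p * lieDerivTensor V D.γ X Z p
      + mvfderiv (𝓡 m) f p (X p) * D.γ p (V p) (Z p)
      + mvfderiv (𝓡 m) f p (Z p) * D.γ p (V p) (X p) := by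
  change lieDerivTensor (f • V) D.γ X Z p = _
  simp only [lieDerivTensor, mlieBracket_smul_left hf hV]
  simp only [Pi.smul_apply', map_add, map_smul, map_neg, _root_.add_apply, _root_.smul_apply,
    _root_.neg_apply, smul_eq_mul, neg_smul, D.symm p (X p) (V p)]
  ring

/-- Collects the derivative along `V` and the brackets with `V` into a Lie derivative, leaving only
derivatives of the one-form `γ(V, ·)`. It is applied with `V = n` and `V = uζ`. -/
theorem koszul_eq_sub_lieDerivTensor :
    D.koszul X Z V p = (1 / 2) * (mvfderiv (𝓡 m) (fun q => D.γ q (V q) (Z q)) p (X p)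
      + mvfderiv (𝓡 m) (fun q => D.γ q (V q) (X q)) p (Z p)
      + D.γ p (V p) (mlieBracket (𝓡 m) X Z p) - lieDerivTensor V D.γ X Z p) := by
  simp only [koszul, lieDerivTensor, mlieBracket_swap_apply (V := X) (W := V),
    mlieBracket_swap_apply (V := Z) (W := V), map_neg, _root_.neg_apply,
    D.mvfderiv_γ_comm (X := V), D.symm p (V p), D.symm p (X p)]
  ring

/-- Put `γ(n, ·) = -n⁽²⁾ ℓ` into `koszul_eq_sub_lieDerivTensor`: derivatives of `ℓ` cancel against
`koszulℓ`, and those of `n⁽²⁾` give `-ℓ ⊗ₛ dn⁽²⁾`. -/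
theorem koszul_n (hX : DiffFieldAt X p) (hZ : DiffFieldAt Z p) :
    D.koszul X Z D.n p + D.n₂ p * D.koszulℓ X Z p = - D.U X Z p := by
  have hγ : ∀ Y : ∀ p : N, TangentSpace (𝓡 m) p,
      (fun q => D.γ q (D.n q) (Y q)) = fun q => - (D.n₂ q * D.ℓ q (Y q)) := fun Y =>
    funext fun q => eq_neg_of_add_eq_zero_left (D.γ_n q (Y q))
  have hd : ∀ Y : ∀ p : N, TangentSpace (𝓡 m) p, DiffFieldAt Y p → ∀ v : TangentSpace (𝓡 m) p,
      mvfderiv (𝓡 m) (fun q => D.γ q (D.n q) (Y q)) p v =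
        - (D.n₂ p * mvfderiv (𝓡 m) (fun q => D.ℓ q (Y q)) p v
          + D.ℓ p (Y p) * mvfderiv (𝓡 m) D.n₂ p v) := fun Y hY v => by
    rw [hγ, mvfderiv_fun_neg, mvfderiv_fun_mul (D.diff_n₂ p) (D.diff_ℓ_apply hY)]
    simp
  rw [koszul_eq_sub_lieDerivTensor, hd Z hZ, hd X hX,
    eq_neg_of_add_eq_zero_left (D.γ_n p (mlieBracket (𝓡 m) X Z p)), koszulℓ, U, symProd]
  ring

end Normal

/-! ### The `𝒜`-dual of the Koszul expressions -/

section Connection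

variable {X X' Z Z' W : ∀ p : N, TangentSpace (𝓡 m) p} {f : N → ℝ} {p : N}

theorem tensorialAt_koszul (hX : DiffFieldAt X p) (hZ : DiffFieldAt Z p) :
    TensorialAt (𝓡 m) (EuclideanSpace ℝ (Fin m)) (D.koszul X Z · p) p where
  smul hf hW := D.koszul_smul_right hf hX hZ hW
  add hW hW' := D.koszul_add_right hX hZ hW hW'

/-- `v` is the vector of `T_p N × ℝ` which represents the Koszul expressions of `X, Z` at `p`
with respect to `𝒜`. -/
def IsKoszulVector (X Z : ∀ p : N, TangentSpace (𝓡 m) p) (p : N)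
    (v : TangentSpace (𝓡 m) p × ℝ) : Prop :=
  ∀ W : ∀ p : N, TangentSpace (𝓡 m) p, DiffFieldAt W p → ∀ b : ℝ,
    D.form p v (W p, b) = D.koszul X Z W p + b * D.koszulℓ X Z p

open scoped Classical in
/-- The vector of `T_p N × ℝ` which represents the Koszul expressions of `X, Z` at `p`. -/
def koszulVector (X Z : ∀ p : N, TangentSpace (𝓡 m) p) (p : N) : TangentSpace (𝓡 m) p × ℝ :=
  if h : DiffFieldAt X p ∧ DiffFieldAt Z p then
    D.sharp p ((TensorialAt.mkHom _ p (D.tensorialAt_koszul h.1 h.2) :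
      TangentSpace (𝓡 m) p →ₗ[ℝ] ℝ).coprod (D.koszulℓ X Z p • LinearMap.id))
  else 0

theorem isKoszulVector_koszulVector (hX : DiffFieldAt X p) (hZ : DiffFieldAt Z p) :
    D.IsKoszulVector X Z p (D.koszulVector X Z p) := by
  intro W hW b
  rw [koszulVector, dif_pos ⟨hX, hZ⟩, form_sharp, LinearMap.coprod_apply]
  congr 1
  · exact TensorialAt.mkHom_apply (D.tensorialAt_koszul hX hZ) hW
  · simp [mul_comm]

variable {D} in
theorem IsKoszulVector.eq {v w : TangentSpace (𝓡 m) p × ℝ} (hv : D.IsKoszulVector X Z p v)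
    (hw : D.IsKoszulVector X Z p w) : v = w := by
  refine D.eq_of_form_eq fun z => ?_
  have hz := FiberBundle.mdifferentiableAt_extend (𝓡 m) (EuclideanSpace ℝ (Fin m)) z.1
  have hv' := hv _ hz z.2
  have hw' := hw _ hz z.2
  rw [FiberBundle.extend_apply_self] at hv' hw'
  exact hv'.trans hw'.symm

theorem koszulVector_add_left (hX : DiffFieldAt X p) (hX' : DiffFieldAt X' p)
    (hZ : DiffFieldAt Z p) :
    D.koszulVector (X + X') Z p = D.koszulVector X Z p + D.koszulVector X' Z p := by
  refine (D.isKoszulVector_koszulVector (mdifferentiableAt_add_section hX hX') hZ).eq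
    fun W hW b => ?_
  rw [map_add, LinearMap.add_apply, D.isKoszulVector_koszulVector hX hZ W hW,
    D.isKoszulVector_koszulVector hX' hZ W hW, D.koszul_add_left hX hX' hZ hW,
    D.koszulℓ_add_left hX hX']
  ring

theorem koszulVector_smul_left (hf : DiffFunAt m f p) (hX : DiffFieldAt X p)
    (hZ : DiffFieldAt Z p) :
    D.koszulVector (f • X) Z p = f p • D.koszulVector X Z p := by
  refine (D.isKoszulVector_koszulVector (hf.smul_section hX) hZ).eq fun W hW b => ?_
  rw [map_smul, LinearMap.smul_apply, D.isKoszulVector_koszulVector hX hZ W hW,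
    D.koszul_smul_left hf hX hZ hW, D.koszulℓ_smul_left hf hX, smul_eq_mul]
  ring

theorem koszulVector_add_right (hX : DiffFieldAt X p) (hZ : DiffFieldAt Z p)
    (hZ' : DiffFieldAt Z' p) :
    D.koszulVector X (Z + Z') p = D.koszulVector X Z p + D.koszulVector X Z' p := by
  refine (D.isKoszulVector_koszulVector hX (mdifferentiableAt_add_section hZ hZ')).eq
    fun W hW b => ?_
  rw [map_add, LinearMap.add_apply, D.isKoszulVector_koszulVector hX hZ W hW,
    D.isKoszulVector_koszulVector hX hZ' W hW, D.koszul_add_middle hX hZ hZ' hW,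
    D.koszulℓ_add_right hZ hZ']
  ring

theorem koszulVector_smul_right (hf : DiffFunAt m f p) (hX : DiffFieldAt X p)
    (hZ : DiffFieldAt Z p) :
    D.koszulVector X (f • Z) p =
      f p • D.koszulVector X Z p + mvfderiv (𝓡 m) f p (X p) • (Z p, 0) := by
  refine (D.isKoszulVector_koszulVector hX (hf.smul_section hZ)).eq fun W hW b => ?_
  rw [map_add, LinearMap.add_apply, map_smul, map_smul, LinearMap.smul_apply,
    LinearMap.smul_apply, D.isKoszulVector_koszulVector hX hZ W hW,
    D.koszul_smul_middle hf hX hZ hW, D.koszulℓ_smul_right hf hZ, form_apply]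
  simp only [smul_eq_mul]
  ring

theorem koszulVector_sub_swap (hX : DiffFieldAt X p) (hZ : DiffFieldAt Z p) :
    D.koszulVector X Z p - D.koszulVector Z X p = (mlieBracket (𝓡 m) X Z p, 0) := by
  rw [sub_eq_iff_eq_add]
  refine (D.isKoszulVector_koszulVector hX hZ).eq fun W hW b => ?_
  rw [map_add, LinearMap.add_apply, D.isKoszulVector_koszulVector hZ hX W hW, form_apply]
  simp only
  rw [← D.koszul_sub_swap, ← D.koszulℓ_sub_swap]
  ring

variable {D} in
-- Pairing with `(n, n⁽²⁾)` extracts the second component, and `koszul_n` evaluates it.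
theorem IsKoszulVector.snd_eq {v : TangentSpace (𝓡 m) p × ℝ} (hv : D.IsKoszulVector X Z p v)
    (hX : DiffFieldAt X p) (hZ : DiffFieldAt Z p) : v.2 = - D.U X Z p := by
  rw [← D.koszul_n hX hZ, ← hv D.n (D.diff_n p), ← D.form_n p v, form_apply, form_apply,
    D.symm p v.1]
  ring

theorem smooth_koszulVector (hX : SmoothFieldAt X p) (hZ : SmoothFieldAt Z p) :
    SmoothFieldAt (fun q => (D.koszulVector X Z q).1) p := by
  -- The pairings of `koszulVector` are known only at points of differentiability, so a whole
  -- neighbourhood of such points is required.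
  have ev : ∀ {Y : ∀ p : N, TangentSpace (𝓡 m) p}, SmoothFieldAt Y p →
      ∀ᶠ q in 𝓝 p, DiffFieldAt Y q := fun hY =>
    ((contMDiffAt_iff_contMDiffAt_nhds (n := 1) (by simp)).1 (hY.of_le (by simp))).mono
      fun q hq => hq.mdifferentiableAt (by simp)
  refine (D.smooth_of_form (a := fun q => (D.koszulVector X Z q).2) (fun W hW => ?_) ?_).1
  · refine (D.smooth_koszul hX hZ hW).congr_of_eventuallyEq ?_
    filter_upwards [ev hX, ev hZ, ev hW] with q hqX hqZ hqW
    simpa using D.isKoszulVector_koszulVector hqX hqZ W hqW 0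
  · refine (D.smooth_koszulℓ hX hZ).congr_of_eventuallyEq ?_
    filter_upwards [ev hX, ev hZ] with q hqX hqZ
    have h0 : DiffFieldAt (0 : ∀ p : N, TangentSpace (𝓡 m) p) q :=
      mdifferentiableAt_zeroSection ..
    have := D.isKoszulVector_koszulVector hqX hqZ _ h0 1
    simpa [(D.tensorialAt_koszul hqX hqZ).zero] using this

end Connection

theorem diff_of_smoothVectorField (X : SmoothVectorField m N) (p : N) : DiffFieldAt (⇑X) p :=
  (X.contMDiff p).mdifferentiableAt (by simp)

/-! ### Existence of the connection -/

section Existence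

variable {X X' Z Z' W : ∀ p : N, TangentSpace (𝓡 m) p} {f : N → ℝ} {p : N}

theorem tensorialAt_koszulVector (hZ : DiffFieldAt Z p) :
    TensorialAt (𝓡 m) (EuclideanSpace ℝ (Fin m)) (fun X => (D.koszulVector X Z p).1) p where
  smul hf hX := by rw [D.koszulVector_smul_left hf hX hZ, Prod.smul_fst]
  add hX hX' := by rw [D.koszulVector_add_left hX hX' hZ, Prod.fst_add]

open scoped Classical in
/-- The metric hypersurface connection as an operator on vector fields. -/
def connectionFun (Z : ∀ p : N, TangentSpace (𝓡 m) p) (p : N) :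
    TangentSpace (𝓡 m) p →L[ℝ] TangentSpace (𝓡 m) p :=
  if h : DiffFieldAt Z p then TensorialAt.mkHom _ p (D.tensorialAt_koszulVector h) else 0

theorem connectionFun_apply (hX : DiffFieldAt X p) (hZ : DiffFieldAt Z p) :
    D.connectionFun Z p (X p) = (D.koszulVector X Z p).1 := by
  rw [connectionFun, dif_pos hZ]
  exact TensorialAt.mkHom_apply (D.tensorialAt_koszulVector hZ) hX

theorem ext_of_diffFieldAt {V : Type*} [AddCommGroup V] [Module ℝ V] [TopologicalSpace V]
    {φ ψ : TangentSpace (𝓡 m) p →L[ℝ] V}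
    (h : ∀ X : ∀ p : N, TangentSpace (𝓡 m) p, DiffFieldAt X p → φ (X p) = ψ (X p)) : φ = ψ := by
  ext v
  simpa using h _ (FiberBundle.mdifferentiableAt_extend (𝓡 m) (EuclideanSpace ℝ (Fin m)) v)

/-- The metric hypersurface connection of `D`. -/
def connection : CovariantDerivative (𝓡 m) (EuclideanSpace ℝ (Fin m))
    (TangentSpace (𝓡 m) : N → Type _) where
  toFun := D.connectionFun
  isCovariantDerivativeOnUniv :=
    { add := fun {Z Z' p} hZ hZ' _ => ext_of_diffFieldAt fun X hX => by
        rw [_root_.add_apply, D.connectionFun_apply hX (mdifferentiableAt_add_section hZ hZ'),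
          D.connectionFun_apply hX hZ, D.connectionFun_apply hX hZ',
          D.koszulVector_add_right hX hZ hZ', Prod.fst_add]
      leibniz := fun {Z f p} hZ hf _ => ext_of_diffFieldAt fun X hX => by
        rw [_root_.add_apply, _root_.smul_apply, ContinuousLinearMap.smulRight_apply,
          D.connectionFun_apply hX (hf.smul_section hZ), D.connectionFun_apply hX hZ,
          D.koszulVector_smul_right hf hX hZ]
        rfl }

theorem connection_apply (hX : DiffFieldAt X p) (hZ : DiffFieldAt Z p) :
    D.connection Z p (X p) = (D.koszulVector X Z p).1 :=
  D.connectionFun_apply hX hZ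

theorem isKoszulVector_connection (hX : DiffFieldAt X p) (hZ : DiffFieldAt Z p) :
    D.IsKoszulVector X Z p (D.connection Z p (X p), - D.U X Z p) := by
  have h := D.isKoszulVector_koszulVector hX hZ
  rwa [D.connection_apply hX hZ, ← h.snd_eq hX hZ]

theorem isConnection_connection : D.IsConnection D.connection where
  smooth := by
    refine ⟨⟨fun {Z} hZ p _ => ContMDiffAt.contMDiffWithinAt ?_⟩⟩
    have hZs : ∀ p, SmoothFieldAt Z p := fun p => (hZ p trivial).contMDiffAt univ_mem
    refine contMDiffAt_hom_of_apply fun X hX => ?_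
    refine (D.smooth_koszulVector hX (hZs p)).congr_of_eventuallyEq ?_
    filter_upwards [(contMDiffAt_iff_contMDiffAt_nhds (n := 1) (by simp)).1
      (hX.of_le (by simp))] with q hq
    rw [← D.connection_apply (hq.mdifferentiableAt (by simp))
      ((hZs q).mdifferentiableAt (by simp))]
  torsion_free p := ext_of_diffFieldAt fun X hX => ext_of_diffFieldAt fun Z hZ => by
    rw [D.connection.torsion_apply hX hZ, D.connection_apply hX hZ, D.connection_apply hZ hX,
      ← Prod.fst_sub, D.koszulVector_sub_swap hX hZ]
    simp
  deriv_γ X Z W p := by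
    have hX := diff_of_smoothVectorField X p
    have hZ := diff_of_smoothVectorField Z p
    have hW := diff_of_smoothVectorField W p
    -- With `b = 0`, adding the Koszul expressions for `(X, Z, W)` and `(X, W, Z)` leaves only
    -- `X(γ(Z, W))`.
    have h1 := D.isKoszulVector_connection hX hZ W hW 0
    have h2 := D.isKoszulVector_connection hX hW Z hZ 0
    rw [form_apply] at h1 h2
    simp only [koszul, mlieBracket_swap_apply (V := W) (W := Z), map_neg, _root_.neg_apply,
      D.mvfderiv_γ_comm (X := W) (Y := Z)] at h1 h2
    rw [D.symm p (Z p)]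
    linarith
  deriv_ℓ X Z p := by
    have hX := diff_of_smoothVectorField X p
    have hZ := diff_of_smoothVectorField Z p
    have h0 : DiffFieldAt (0 : ∀ p : N, TangentSpace (𝓡 m) p) p :=
      mdifferentiableAt_zeroSection ..
    -- `W = 0`, `b = 1` isolates `koszulℓ`; symmetrizing in `X, Z` removes its bracket.
    have h1 := D.isKoszulVector_connection hX hZ 0 h0 1
    have h2 := D.isKoszulVector_connection hZ hX 0 h0 1
    rw [form_apply, (D.tensorialAt_koszul hX hZ).zero] at h1
    rw [form_apply, (D.tensorialAt_koszul hZ hX).zero] at h2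
    simp only [koszulℓ, mlieBracket_swap_apply (V := Z) (W := X), map_neg, Pi.zero_apply, map_zero,
      D.U_comm (X := Z) (Z := X)] at h1 h2
    linarith

end Existence

/-! ### Uniqueness of the connection -/

section Uniqueness

variable {D}
  {cov cov' : CovariantDerivative (𝓡 m) (EuclideanSpace ℝ (Fin m))
    (TangentSpace (𝓡 m) : N → Type _)}

/-- Koszul's argument: brackets are traded for covariant derivatives by vanishing torsion, then
three cyclic copies of the `γ` equation are combined with the `ℓ` equation. -/
theorem IsConnection.isKoszulVector [T2Space N] (h : D.IsConnection cov) (X Z : SmoothVectorField m N)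
    (p : N) : D.IsKoszulVector X Z p (cov Z p (X p), - D.U X Z p) := by
  have hX := diff_of_smoothVectorField X p
  have hZ := diff_of_smoothVectorField Z p
  have tors : ∀ X Y : SmoothVectorField m N, cov Y p (X p) - cov X p (Y p) =
      mlieBracket (𝓡 m) X Y p := fun X Y => by
    have := cov.torsion_apply (diff_of_smoothVectorField X p) (diff_of_smoothVectorField Y p)
    rw [h.torsion_free p] at this
    exact (sub_eq_zero.1 this.symm)
  intro W hW b
  obtain ⟨Y, hY⟩ := exists_smoothVectorField_apply_eq (W p)
  have hYd := diff_of_smoothVectorField Y p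
  -- By tensoriality `W` may be replaced by a global smooth field with the same value at `p`.
  rw [← hY, ← (D.tensorialAt_koszul hX hZ).pointwise hYd hW hY, form_apply]
  have e1 := h.deriv_γ X Z Y p
  have e2 := h.deriv_γ Z X Y p
  have e3 := h.deriv_γ Y X Z p
  have e4 := h.deriv_ℓ X Z p
  simp only [D.U_comm (X := Z) (Z := X), D.U_comm (X := Y)] at e2 e3
  simp only [koszul, koszulℓ, ← tors, map_sub, _root_.sub_apply]
  simp only [D.symm p (X p) (cov _ _ _), D.symm p (Z p) (cov _ _ _)] at *
  linear_combination -(1 / 2) * (e1 + e2 - e3) - b / 2 * e4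

theorem difference_apply (X Z : SmoothVectorField m N) (p : N) :
    cov.difference cov' p (Z p) (X p) = cov Z p (X p) - cov' Z p (X p) := by
  have := IsCovariantDerivativeOn.difference_apply cov.isCovariantDerivativeOnUniv
    cov'.isCovariantDerivativeOnUniv (x := p) (σ := Z) (hσ := diff_of_smoothVectorField Z p)
  exact congrArg (· (X p)) this

theorem IsConnection.difference_eq_zero [T2Space N] (h : D.IsConnection cov) (h' : D.IsConnection cov') :
    cov.difference cov' = 0 := by
  ext p z x
  obtain ⟨Z, rfl⟩ := exists_smoothVectorField_apply_eq z
  obtain ⟨X, rfl⟩ := exists_smoothVectorField_apply_eq x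
  have hcov := (Prod.ext_iff.1 ((h.isKoszulVector X Z p).eq (h'.isKoszulVector X Z p))).1
  rw [difference_apply, sub_eq_zero.2 hcov]
  rfl

end Uniqueness

/-! ### Behaviour under gauge transformations -/

section Gauge

variable {u : C^∞⟮𝓡 m, N; 𝓘(ℝ, ℝ), ℝ⟯} (hu : ∀ p, u p ≠ 0) (ζ : SmoothVectorField m N)
  {X Z W : ∀ p : N, TangentSpace (𝓡 m) p} {p : N}

theorem koszul_gauge : (D.gauge u hu ζ).koszul X Z W p = D.koszul X Z W p := rfl

theorem form_gauge (p : N) (x y : TangentSpace (𝓡 m) p × ℝ) :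
    (D.gauge u hu ζ).form p x y =
      D.form p (x.1 + (u p * x.2) • ζ p, u p * x.2) (y.1 + (u p * y.2) • ζ p, u p * y.2) := by
  simp [form_apply, gauge, D.symm p x.1 (ζ p)]
  ring

/-- The tensor `£_{uζ} γ + 2 ℓ ⊗ₛ du` which governs the change of the transverse Koszul
expression under a gauge transformation. -/
def gaugeTensor (u : N → ℝ) (ζ X Z : ∀ p : N, TangentSpace (𝓡 m) p) (p : N) : ℝ :=
  lieDerivTensor (fun q => u q • ζ q) D.γ X Z p
    + 2 * symProd (D.ℓ p) (mvfderiv (𝓡 m) u p) (X p) (Z p)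

theorem koszulℓ_gauge (hX : DiffFieldAt X p) (hZ : DiffFieldAt Z p) :
    (D.gauge u hu ζ).koszulℓ X Z p = u p * D.koszulℓ X Z p + u p * D.koszul X Z ζ p
      + (1 / 2) * D.gaugeTensor u ζ X Z p := by
  have hud : DiffFunAt m u p := (u.contMDiff p).mdifferentiableAt (by simp)
  have hζ := diff_of_smoothVectorField ζ p
  have huζ : DiffFieldAt ((u : N → ℝ) • (ζ : ∀ p : N, TangentSpace (𝓡 m) p)) p :=
    hud.smul_section hζ
  have hd : ∀ Y : ∀ p : N, TangentSpace (𝓡 m) p, DiffFieldAt Y p → ∀ v : TangentSpace (𝓡 m) p,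
      mvfderiv (𝓡 m) (fun q => (D.gauge u hu ζ).ℓ q (Y q)) p v =
        u p * mvfderiv (𝓡 m) (fun q => D.ℓ q (Y q)) p v + D.ℓ p (Y p) * mvfderiv (𝓡 m) u p v
          + mvfderiv (𝓡 m)
            (fun q => D.γ q (((u : N → ℝ) • (ζ : ∀ p : N, TangentSpace (𝓡 m) p)) q) (Y q)) p v := by
    intro Y hY v
    have : (fun q => (D.gauge u hu ζ).ℓ q (Y q)) = fun q => u q * D.ℓ q (Y q)
        + D.γ q (((u : N → ℝ) • (ζ : ∀ p : N, TangentSpace (𝓡 m) p)) q) (Y q) := by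
      funext q
      simp [gauge, mul_add]
    have hm : DiffFunAt m (fun q => u q * D.ℓ q (Y q)) p := hud.mul (D.diff_ℓ_apply hY)
    rw [this, mvfderiv_fun_add hm (D.diff_γ_apply huζ hY), mvfderiv_fun_mul hud (D.diff_ℓ_apply hY)]
    simp
  -- Moving `u` into the third slot makes the derivatives of `γ(uζ, ·)` match those in `hd`; the Lie
  -- derivative then cancels the one in `gaugeTensor`.
  rw [← D.koszul_smul_right hud hX hZ hζ, koszul_eq_sub_lieDerivTensor, koszulℓ, hd Z hZ, hd X hX,
    koszulℓ, gaugeTensor, symProd]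
  change _ = _ + (1 / 2) * (_ + _ + _ - lieDerivTensor (fun q => u q • ζ q) D.γ X Z p) + _
  simp only [gauge, Pi.smul_apply', map_smul, _root_.smul_apply, _root_.add_apply, smul_eq_mul]
  ring

variable {D ζ} in
theorem IsKoszulVector.gauge {v v' : TangentSpace (𝓡 m) p × ℝ}
    (hv : D.IsKoszulVector X Z p v) (hv' : (D.gauge u hu ζ).IsKoszulVector X Z p v')
    (hX : DiffFieldAt X p) (hZ : DiffFieldAt Z p) :
    (v'.1 + (u p * v'.2) • ζ p, u p * v'.2) =
      v + (1 / (2 * u p) * D.gaugeTensor u ζ X Z p) • (D.n p, D.n₂ p) := by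
  have hζ := diff_of_smoothVectorField ζ p
  have hup := hu p
  refine D.eq_of_form_eq fun z => ?_
  obtain ⟨w, b⟩ := z
  obtain ⟨W, hW, rfl⟩ : ∃ W : ∀ p : N, TangentSpace (𝓡 m) p, DiffFieldAt W p ∧ W p = w :=
    ⟨_, FiberBundle.mdifferentiableAt_extend (𝓡 m) (EuclideanSpace ℝ (Fin m)) w, by simp⟩
  have hc : DiffFunAt m (fun _ : N => -b) p := mdifferentiableAt_const
  have hcζ : DiffFieldAt ((fun _ : N => -b) • (ζ : ∀ p : N, TangentSpace (𝓡 m) p)) p :=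
    hc.smul_section hζ
  -- `(W - bζ, b/u)` is the preimage of `(W, b)` under the isometry of `form_gauge`.
  have h := hv' _ (mdifferentiableAt_add_section hW hcζ) ((u p)⁻¹ * b)
  have hz : (W p, b) = ((W + (fun _ : N => -b) • (ζ : ∀ p : N, TangentSpace (𝓡 m) p)) p
      + (u p * ((u p)⁻¹ * b)) • ζ p, u p * ((u p)⁻¹ * b)) := by
    simp [mul_inv_cancel_left₀ hup]
  rw [koszul_gauge, D.koszul_add_right hX hZ hW hcζ, D.koszul_smul_right hc hX hZ hζ,
    D.koszulℓ_gauge hu ζ hX hZ, form_gauge, ← hz] at h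
  rw [h, map_add, LinearMap.add_apply, hv W hW, map_smul, LinearMap.smul_apply, form_n]
  simp only [smul_eq_mul]
  field_simp
  ring

theorem lieDerivTensor_smul_n (hu : DiffFunAt m u p) :
    lieDerivTensor (fun q => u q • D.n q) D.γ X Z p = u p * lieDerivTensor D.n D.γ X Z p
      - 2 * D.n₂ p * symProd (D.ℓ p) (mvfderiv (𝓡 m) u p) (X p) (Z p) := by
  rw [D.lieDerivTensor_smul hu (D.diff_n p), eq_neg_of_add_eq_zero_left (D.γ_n p (Z p)),
    eq_neg_of_add_eq_zero_left (D.γ_n p (X p)), symProd]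
  ring

end Gauge

end MetricHypersurfaceData

end

/-! ### The main theorem -/

theorem mainTheorem8 {m : ℕ} {N : Type*} [TopologicalSpace N] [T2Space N]
    [ChartedSpace (EuclideanSpace ℝ (Fin m)) N] [IsManifold (𝓡 m) ∞ N]
    (D : MetricHypersurfaceData m N)
    (u : C^∞⟮𝓡 m, N; 𝓘(ℝ, ℝ), ℝ⟯) (hu : ∀ p, u p ≠ 0) (ζ : SmoothVectorField m N) :
    (∃ cov, D.IsConnection cov ∧
      ∀ cov₁, D.IsConnection cov₁ → cov₁.difference cov = 0) ∧
    (∃ cov', (D.gauge u hu ζ).IsConnection cov' ∧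
      ∀ cov₁, (D.gauge u hu ζ).IsConnection cov₁ → cov₁.difference cov' = 0) ∧
    ∀ cov cov', D.IsConnection cov → (D.gauge u hu ζ).IsConnection cov' →
      ∀ (X Z : SmoothVectorField m N) (p : N),
        cov'.difference cov p (Z p) (X p) =
          (1 / (2 * u p) *
            (lieDerivTensor (fun q => u q • D.n q) D.γ X Z p
              - D.n₂ p * lieDerivTensor (fun q => u q • ζ q) D.γ X Z p
              + 2 * u p * symProd (D.ℓ p) (mvfderiv (𝓡 m) D.n₂ p) (X p) (Z p))) • ζ p
          + (1 / (2 * u p) *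
            (lieDerivTensor (fun q => u q • ζ q) D.γ X Z p
              + 2 * symProd (D.ℓ p) (mvfderiv (𝓡 m) u p) (X p) (Z p))) • D.n p := by
  refine ⟨⟨D.connection, D.isConnection_connection, fun _ h =>
      h.difference_eq_zero D.isConnection_connection⟩,
    ⟨(D.gauge u hu ζ).connection, (D.gauge u hu ζ).isConnection_connection, fun _ h =>
      h.difference_eq_zero (D.gauge u hu ζ).isConnection_connection⟩, ?_⟩
  intro cov cov' h h' X Z p
  have hup := hu p
  have hud : MDifferentiableAt (𝓡 m) 𝓘(ℝ, ℝ) u p :=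
    (u.contMDiff p).mdifferentiableAt (by simp)
  have key := (h.isKoszulVector X Z p).gauge hu (h'.isKoszulVector X Z p)
    (MetricHypersurfaceData.diff_of_smoothVectorField X p)
    (MetricHypersurfaceData.diff_of_smoothVectorField Z p)
  obtain ⟨k1, k2⟩ := Prod.ext_iff.1 key
  simp only [Prod.fst_add, Prod.snd_add, Prod.smul_fst, Prod.smul_snd, smul_eq_mul] at k1 k2
  rw [MetricHypersurfaceData.difference_apply, D.lieDerivTensor_smul_n hud]
  -- The second component eliminates the transformed `U`, so only original data remain.
  rw [k2] at k1
  rw [eq_sub_of_add_eq k1, MetricHypersurfaceData.gaugeTensor, MetricHypersurfaceData.U]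
  match_scalars
  · ring
  · ring
  · field_simp
    ring
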